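/- Let $\mathcal X$ be a measurable space (for instance $\mathcal X=\mathcal S\times\mathcal A$), let $\rho$ be a probability measure on $\mathcal X$, and let $\mathcal H$ be a real reproducing kernel Hilbert space on $\mathcal X$ with kernel $k$, norm $\|\cdot\|_{\mathcal K}$, and $k(x,x)\le 1$ for all $x\in\mathcal X$. Assume that the feature map $x\mapsto k(\cdot,x)\in\mathcal H$ is strongly (Bochner) measurable with respect to $\rho$; this holds, for example, if $\mathcal H$ is separable and $k$ is measurable. Let $\mathscr T:L^2(\rho)\to L^2(\rho)$ be the integral operator $(\mathscr Tf)(x)=\mathbb E_{y\sim\rho}[k(x,y)f(y)]$, and let $\lambda_1\ge\lambda_2\ge\cdots$ be its eigenvalues in nonincreasing order, repeated according to multiplicity (and continued by zeros if only finitely many are nonzero). For $n\ge 1$ and a class $\mathcal G$ of real functions on $\mathcal X$ let $$\mathcal R_n^\rho(\mathcal G)=\mathbb E\Big[\sup_{f\in\mathcal G}\frac1n\sum_{i=1}^n\sigma_i f(x_i)\Big],$$ where $x_1,\dots,x_n$ are i.i.d. with law $\rho$ and $\sigma_1,\dots,\sigma_n$ are independent uniform signs, independent of the $x_i$. Put $\|q\|_\rho^2=\mathbb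 E_{x\sim\rho}[q(x)^2]$. A function $\psi:[0,\infty)\to[0,\infty)$ is sub-root if it is nondecreasing and $r\mapsto\psi(r)/\sqrt r$ is nonincreasing on $(0,\infty)$. For a class $\mathcal F$ and $f_o\in\mathcal F$, the critical radius $r_n^{\star,\rho}(\mathcal F,f_o)$ is the infimum of the set of all $r^\star>0$ for which there is a sub-root function $\psi$ with $\psi(r^\star)=r^\star$ and $\mathcal R_n^\rho(\{f\in\mathcal F:\|f-f_o\|_\rho^2\le r\})\le\psi(r)$ for every $r\ge r^\star$. Then, for every real $H$, every class $\mathcal F\subseteq\{f\in\mathcal H:\|f\|_{\mathcal K}\le H\}$, every $f_o\in\mathcal F$ and every $n\ge1$: $\sum_i\lambda_i<\infty$, the expectation defining $\mathcal R_n^\rho(\mathcal F)$ exists, the set whose infimum is the critical radius is nonempty, and $$\mathcal R_n^\rho(\mathcal F)\le H\sqrt{\frac2n\sum_{i=1}^\infty\min(1,4\lambda_i)},\qquad r_n^{\star,\rho}(\mathcal F,f_o)\le 2\min_{j\in\{0,1,2,\dots\}}\Big\{\frac jn+H\sqrt{\frac2n\sum_{i=j+1}^\infty\lambda_i}\Big\}.$$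 -/

import Mathlib

open MeasureTheory

noncomputable section

/-! ### Rademacher complexity -/

/-- The empirical Rademacher complexity
`E_σ [sup_{f ∈ F} (1/n) ∑ i, σ i * f (x i)]` of the class `F` at the points `x`. The signs `σ` are
uniform on `{-1, 1}ⁿ`, so the expectation is the average over the `2 ^ n` sign vectors. -/
def empiricalRademacher {X : Type*} {n : ℕ} (F : Set (X → ℝ)) (x : Fin n → X) : ℝ :=
  (2 ^ n : ℝ)⁻¹ * ∑ σ : Fin n → ℤˣ,
    ⨆ f : F, (1 / (n : ℝ)) * ∑ i, ((σ i : ℤ) : ℝ) * (f : X → ℝ) (x i)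

/-- The population Rademacher complexity for `n` independent samples from `ρ`. -/
def rademacher {X : Type*} [MeasurableSpace X] (n : ℕ) (ρ : Measure X) [SigmaFinite ρ]
    (F : Set (X → ℝ)) : ℝ :=
  ∫ x : Fin n → X, empiricalRademacher F x ∂(Measure.pi fun _ => ρ)

/-- `‖q‖_ρ ^ 2 = E_{x ∼ ρ} [q x ^ 2]`. -/
def sqNorm {X : Type*} [MeasurableSpace X] (ρ : Measure X) (q : X → ℝ) : ℝ :=
  ∫ x, q x ^ 2 ∂ρ

/-- A sub-root function on `[0, ∞)` (the values at negative arguments are irrelevant). -/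
structure IsSubRoot (ψ : ℝ → ℝ) : Prop where
  nonneg : ∀ r, 0 ≤ r → 0 ≤ ψ r
  mono : MonotoneOn ψ (Set.Ici 0)
  anti : AntitoneOn (fun r => ψ r / √r) (Set.Ioi 0)

/-- The set of positive fixed points of sub-root functions `ψ` that dominate, from the fixed point
on, the local Rademacher complexity `r ↦ R_n({f ∈ F | T f ≤ r})`. (A sub-root function has at most
one positive fixed point; the trivial fixed point `0`, e.g. of `√`, is not meant.) -/
def criticalRadiusSet {X : Type*} [MeasurableSpace X] (n : ℕ) (ρ : Measure X) [SigmaFinite ρ]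
    (F : Set (X → ℝ)) (T : (X → ℝ) → ℝ) : Set ℝ :=
  {r | 0 < r ∧ ∃ ψ : ℝ → ℝ, IsSubRoot ψ ∧ ψ r = r ∧
    ∀ s, r ≤ s → rademacher n ρ {f ∈ F | T f ≤ s} ≤ ψ s}

/-- The critical radius of the local Rademacher complexity `R_n({f ∈ F | ‖f - f₀‖_ρ ^ 2 ≤ r})`. -/
def criticalRadius {X : Type*} [MeasurableSpace X] (n : ℕ) (ρ : Measure X) [SigmaFinite ρ]
    (F : Set (X → ℝ)) (f₀ : X → ℝ) : ℝ :=
  sInf (criticalRadiusSet n ρ F fun f => sqNorm ρ (f - f₀))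

/-! ### Integral operators and their eigenvalues -/

section IntegralOperator

variable {X : Type*} [MeasurableSpace X] {ρ : Measure X} [IsProbabilityMeasure ρ]

theorem ae_memLp_kernel_section {k : X → X → ℝ}
    (hk : MemLp (fun p : X × X => k p.1 p.2) 2 (ρ.prod ρ)) :
    ∀ᵐ x ∂ρ, MemLp (k x) 2 ρ := by
  have h1 := (memLp_two_iff_integrable_sq hk.1).1 hk
  filter_upwards [h1.prod_right_ae, hk.1.prodMk_left] with x hx hx'
  exact (memLp_two_iff_integrable_sq hx').2 hx

theorem aestronglyMeasurable_integralTransform {k : X → X → ℝ}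
    (hk : MemLp (fun p : X × X => k p.1 p.2) 2 (ρ.prod ρ)) (f : Lp ℝ 2 ρ) :
    AEStronglyMeasurable (fun x => ∫ y, k x y * f y ∂ρ) ρ :=
  (hk.1.mul (Lp.aestronglyMeasurable f).comp_snd).integral_prod_right'

theorem sq_integral_mul_le {ρ : Measure X} {u v : X → ℝ} (hu : MemLp u 2 ρ) (hv : MemLp v 2 ρ) :
    (∫ y, u y * v y ∂ρ) ^ 2 ≤ (∫ y, u y ^ 2 ∂ρ) * ∫ y, v y ^ 2 ∂ρ := by
  have hu2 := hu.integrable_sq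
  have hv2 := hv.integrable_sq
  have huv : Integrable (fun y => u y * v y) ρ := hu.integrable_mul hv
  have key : ∀ t : ℝ, 0 ≤ (∫ y, v y ^ 2 ∂ρ) * (t * t) + (2 * ∫ y, u y * v y ∂ρ) * t
      + ∫ y, u y ^ 2 ∂ρ := by
    intro t
    have h : ∫ y, (u y + t * v y) ^ 2 ∂ρ = (∫ y, v y ^ 2 ∂ρ) * (t * t)
        + (2 * ∫ y, u y * v y ∂ρ) * t + ∫ y, u y ^ 2 ∂ρ := by
      have : (fun y => (u y + t * v y) ^ 2)
          = fun y => (t * t) * v y ^ 2 + ((2 * t) * (u y * v y) + u y ^ 2) := by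
        funext y; ring
      have h2 : Integrable (fun y => (2 * t) * (u y * v y) + u y ^ 2) ρ :=
        (huv.const_mul _).add hu2
      rw [this, integral_add (hv2.const_mul _) h2, integral_add (huv.const_mul _) hu2,
        integral_const_mul, integral_const_mul]
      ring
    rw [← h]
    exact integral_nonneg fun y => sq_nonneg _
  have := discrim_le_zero key
  rw [discrim] at this
  nlinarith

theorem memLp_integralTransform {k : X → X → ℝ}
    (hk : MemLp (fun p : X × X => k p.1 p.2) 2 (ρ.prod ρ)) (f : Lp ℝ 2 ρ) :
    MemLp (fun x => ∫ y, k x y * f y ∂ρ) 2 ρ := by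
  have hm := aestronglyMeasurable_integralTransform hk f
  rw [memLp_two_iff_integrable_sq hm]
  have hb : Integrable (fun x => (∫ y, k x y ^ 2 ∂ρ) * ∫ y, f y ^ 2 ∂ρ) ρ :=
    hk.integrable_sq.integral_prod_left.mul_const _
  refine hb.mono' (hm.pow 2) ?_
  filter_upwards [ae_memLp_kernel_section hk] with x hx
  rw [Real.norm_of_nonneg (sq_nonneg _)]
  exact sq_integral_mul_le hx (Lp.memLp f)

end IntegralOperator

/-- The integral operator `(T f) x = E_{y ∼ ρ} [k x y * f y]` on `L²(ρ)`, for a kernel in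
`L²(ρ × ρ)`. -/
def integralOperator {X : Type*} [MeasurableSpace X] (ρ : Measure X) [IsProbabilityMeasure ρ]
    (k : X → X → ℝ)
    (hk : MemLp (fun p : X × X => k p.1 p.2) 2 (ρ.prod ρ)) : Lp ℝ 2 ρ →ₗ[ℝ] Lp ℝ 2 ρ where
  toFun f := (memLp_integralTransform hk f).toLp _
  map_add' f g := by
    rw [← MemLp.toLp_add, MemLp.toLp_eq_toLp_iff]
    filter_upwards [ae_memLp_kernel_section hk] with x hx
    have h1 : Integrable (fun y => k x y * f y) ρ := hx.integrable_mul (Lp.memLp f)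
    have h2 : Integrable (fun y => k x y * g y) ρ := hx.integrable_mul (Lp.memLp g)
    rw [Pi.add_apply, ← integral_add h1 h2]
    refine integral_congr_ae ?_
    filter_upwards [Lp.coeFn_add f g] with y hy
    rw [hy, Pi.add_apply, mul_add]
  map_smul' c f := by
    rw [RingHom.id_apply, ← MemLp.toLp_const_smul, MemLp.toLp_eq_toLp_iff]
    refine Filter.Eventually.of_forall fun x => ?_
    rw [Pi.smul_apply, smul_eq_mul, ← integral_const_mul]
    refine integral_congr_ae ?_
    filter_upwards [Lp.coeFn_smul c f] with y hy
    rw [hy, Pi.smul_apply, smul_eq_mul]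
    ring

/-- `lam 0 ≥ lam 1 ≥ …` lists the eigenvalues of `T` in nonincreasing order: each nonzero number
occurs as often as its multiplicity (the dimension of its eigenspace) says. If a positive operator
has only finitely many nonzero eigenvalues, the list is thereby filled up with zeros. -/
structure IsEigenvalueSequence {E : Type*} [AddCommGroup E] [Module ℝ E] (T : E →ₗ[ℝ] E)
    (lam : ℕ → ℝ) : Prop where
  antitone : Antitone lam
  encard_eq : ∀ μ : ℝ, μ ≠ 0 →
    {i | lam i = μ}.encard = Cardinal.toENat (Module.rank ℝ (Module.End.eigenspace T μ))

/-! ### Scalar reproducing kernel Hilbert spaces -/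

section Kernel

variable {X : Type*} (𝓗 : Type*) [NormedAddCommGroup 𝓗] [InnerProductSpace ℝ 𝓗] [CompleteSpace 𝓗]
  [RKHS ℝ 𝓗 X ℝ]

/-- The reproducing kernel `k x y` of a space of real functions. -/
def scalarKernel (x y : X) : ℝ := RKHS.kernel 𝓗 x y 1

/-- The kernel function `k(·, x)` as an element of the space. -/
def kernelSection (x : X) : 𝓗 := RKHS.kerFun 𝓗 x 1

theorem scalarKernel_eq_inner (x y : X) :
    scalarKernel 𝓗 x y = inner ℝ (kernelSection 𝓗 x) (kernelSection 𝓗 y) := by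
  have h := RKHS.kernel_inner 𝓗 x y (1 : ℝ) (1 : ℝ)
  rw [real_inner_comm, kernelSection, kernelSection, ← h]
  simp [scalarKernel]

variable [MeasurableSpace X] {ρ : Measure X} [IsProbabilityMeasure ρ]

theorem memLp_scalarKernel (hmeas : AEStronglyMeasurable (kernelSection 𝓗) ρ)
    (hk : ∀ x, scalarKernel 𝓗 x x ≤ 1) :
    MemLp (fun p : X × X => scalarKernel 𝓗 p.1 p.2) 2 (ρ.prod ρ) := by
  have hn : ∀ x, ‖kernelSection 𝓗 x‖ ≤ 1 := fun x => by
    have h := hk x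
    rw [scalarKernel_eq_inner, real_inner_self_eq_norm_sq] at h
    exact (sq_le_one_iff₀ (norm_nonneg _)).1 h
  refine MemLp.of_bound (C := 1) ?_ (Filter.Eventually.of_forall fun p => ?_)
  · simp only [scalarKernel_eq_inner]
    exact AEStronglyMeasurable.inner (𝕜 := ℝ) hmeas.comp_fst hmeas.comp_snd
  · rw [scalarKernel_eq_inner]
    exact (norm_inner_le_norm _ _).trans (mul_le_one₀ (hn _) (norm_nonneg _) (hn _))

end Kernel

end

/-! Everything is read off the feature map Φ(x) = k(·,x). The map J g = ⟨g, Φ(·)⟩ from the Hilbert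
space to L²(ρ) is compact, and the integral operator equals J J†. Hence J has right singular vectors
e_i with ‖J e_i‖² = λ_i, which are eigenvectors of the covariance operator of Φ. They are taken to
be 0 where λ_i = 0, so that they share the index set of the eigenvalues. For almost every x the
vector Φ(x) lies in their closed span, and Parseval gives the trace formula E‖Φ‖² = ∑ λ_i ≤ 1.

Since f(x) = ⟨g, Φ(x)⟩, a signed sum over the sample is the inner product of g with ∑ σ_i Φ(x_i).
Cauchy–Schwarz, Jensen and orthogonality of the signs bound the global complexity by H √(∑ λ_i / n),
and λ_i ≤ min(1, 4λ_i) because every λ_i ≤ 1.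

For the local complexity write f - f₀ = ⟨h, Φ⟩ with ‖h‖ ≤ 2H. On the first j directions rescale h by
√λ_l and Φ by its inverse: the rescaled h has norm at most ‖f - f₀‖_ρ ≤ √s, and the rescaled Φ has
second moment at most j. The rest of Φ has second moment ∑_{i>j} λ_i. This gives the sub-root bound
A√s + B with A² = j/n and B = 2H √(∑_{i>j} λ_i / n) (`rademacher_local_le`), whose fixed point is at
most 2A² + √2 B (`exists_fixed_point_mul_sqrt_add`). -/

open MeasureTheory

/-! ### Bessel and Parseval for orthonormal families padded with zeros -/

section PartialOrthonormal

variable {E : Type*} [NormedAddCommGroup E] [InnerProductSpace ℝ E]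

/-- A family of pairwise orthogonal vectors each of which is zero or a unit vector. -/
structure IsPartialOrthonormal {ι : Type*} (e : ι → E) : Prop where
  inner_eq_zero : ∀ i k, i ≠ k → inner ℝ (e i) (e k) = 0
  zero_or_unit : ∀ i, e i = 0 ∨ ‖e i‖ = 1

namespace IsPartialOrthonormal

variable {ι : Type*} {e : ι → E}

theorem inner_sum_smul (he : IsPartialOrthonormal e) (s : Finset ι) (c d : ι → ℝ) :
    inner ℝ (∑ i ∈ s, c i • e i) (∑ i ∈ s, d i • e i) = ∑ i ∈ s, c i * d i * ‖e i‖ ^ 2 := by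
  classical
  rw [sum_inner]
  refine Finset.sum_congr rfl fun i hi => ?_
  rw [inner_sum, Finset.sum_eq_single i]
  · rw [real_inner_smul_left, real_inner_smul_right, real_inner_self_eq_norm_sq, mul_assoc]
  · intro k _ hk
    rw [real_inner_smul_left, real_inner_smul_right, he.inner_eq_zero i k hk.symm]
    simp
  · exact fun h => absurd hi h

theorem norm_sq_le_one (he : IsPartialOrthonormal e) (i : ι) : ‖e i‖ ^ 2 ≤ 1 := by
  rcases he.zero_or_unit i with h | h <;> simp [h]

theorem norm_sum_smul_sq_le (he : IsPartialOrthonormal e) (s : Finset ι) (c : ι → ℝ) :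
    ‖∑ i ∈ s, c i • e i‖ ^ 2 ≤ ∑ i ∈ s, c i ^ 2 := by
  rw [← real_inner_self_eq_norm_sq, he.inner_sum_smul]
  refine Finset.sum_le_sum fun i _ => ?_
  have := mul_le_mul_of_nonneg_left (he.norm_sq_le_one i) (sq_nonneg (c i))
  nlinarith

theorem norm_sub_sum_sq (he : IsPartialOrthonormal e) (s : Finset ι) (v : E) :
    ‖v - ∑ i ∈ s, inner ℝ (e i) v • e i‖ ^ 2 = ‖v‖ ^ 2 - ∑ i ∈ s, inner ℝ (e i) v ^ 2 := by
  rw [norm_sub_sq_real, ← real_inner_self_eq_norm_sq (∑ i ∈ s, _), he.inner_sum_smul, inner_sum]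
  have h1 : ∑ i ∈ s, inner ℝ v (inner ℝ (e i) v • e i) = ∑ i ∈ s, inner ℝ (e i) v ^ 2 := by
    refine Finset.sum_congr rfl fun i _ => ?_
    rw [real_inner_smul_right, real_inner_comm]; ring
  have h2 : ∑ i ∈ s, inner ℝ (e i) v * inner ℝ (e i) v * ‖e i‖ ^ 2
      = ∑ i ∈ s, inner ℝ (e i) v ^ 2 := by
    refine Finset.sum_congr rfl fun i _ => ?_
    rcases he.zero_or_unit i with h | h <;> simp [h, sq]
  rw [h1, h2]; ring

theorem sum_inner_sq_le (he : IsPartialOrthonormal e) (s : Finset ι) (v : E) :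
    ∑ i ∈ s, inner ℝ (e i) v ^ 2 ≤ ‖v‖ ^ 2 := by
  have h := he.norm_sub_sum_sq s v
  nlinarith [sq_nonneg ‖v - ∑ i ∈ s, inner ℝ (e i) v • e i‖]

/-- Parseval's identity for a vector in the closed span of the family. -/
theorem hasSum_inner_sq [CompleteSpace E] (he : IsPartialOrthonormal e) {v : E}
    (hv : ∀ c, (∀ i, inner ℝ (e i) c = 0) → inner ℝ c v = 0) :
    HasSum (fun i => inner ℝ (e i) v ^ 2) (‖v‖ ^ 2) := by
  have ho : Orthonormal ℝ (fun i : {i // e i ≠ 0} => e i) :=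
    ⟨fun i => (he.zero_or_unit i).resolve_left i.2,
      fun i k hik => he.inner_eq_zero i k fun h => hik (Subtype.ext h)⟩
  have hr : Orthonormal ℝ ((↑) : Set.range (fun i : {i // e i ≠ 0} => e i) → E) :=
    ho.toSubtypeRange
  obtain ⟨w, b, hsub, hb⟩ := hr.exists_hilbertBasis_extension
  have hsum := b.hasSum_inner_mul_inner v v
  rw [real_inner_self_eq_norm_sq] at hsum
  let p : {i // e i ≠ 0} → w := fun i => ⟨e i, hsub ⟨i, rfl⟩⟩
  have hp : Function.Injective p := fun i k hik => ho.linearIndependent.injective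
    (congrArg Subtype.val hik)
  -- A basis vector added in the extension is orthogonal to every `e i`, so the hypothesis on `v`
  -- makes its coefficient vanish.
  have hout : ∀ x, x ∉ Set.range p → inner ℝ v (b x) * inner ℝ (b x) v = 0 := by
    intro x hx
    rw [hv (b x), mul_zero]
    intro i
    by_cases hi : e i = 0
    · rw [hi, inner_zero_left]
    · have hne : p ⟨i, hi⟩ ≠ x := fun h => hx ⟨_, h⟩
      have := b.orthonormal.2 hne
      rw [hb] at this ⊢
      exact this
  have h2 := (hp.hasSum_iff hout).2 hsum
  have h3 : (fun x => inner ℝ v (b x) * inner ℝ (b x) v) ∘ p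
      = (fun i => inner ℝ (e i) v ^ 2) ∘ ((↑) : {i | e i ≠ 0} → ι) := by
    funext i
    simp only [Function.comp_apply, hb, p]
    rw [real_inner_comm, sq]
  rw [h3] at h2
  refine (hasSum_subtype_iff_of_support_subset ?_).1 h2
  intro i hi h0
  exact hi (by simp [h0])

end IsPartialOrthonormal

end PartialOrthonormal

/-! ### Spectral theorem and singular vectors along an eigenvalue sequence -/

section EigenvalueSequence

variable {E : Type*} [NormedAddCommGroup E] [InnerProductSpace ℝ E] [CompleteSpace E]

-- Compactness makes the eigenspace finite-dimensional, so exactly dim-many indices carry the value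
-- `μ` and an orthonormal basis can be relabelled by them.
open Module.End in
theorem exists_orthonormal_basis_eigenspace {T : E →L[ℝ] E} (hT : IsCompactOperator T)
    {lam : ℕ → ℝ} (hlam : IsEigenvalueSequence (T : E →ₗ[ℝ] E) lam) {μ : ℝ} (hμ : μ ≠ 0) :
    ∃ ψ : ℕ → E, (∀ i, lam i = μ → T (ψ i) = μ • ψ i ∧ ‖ψ i‖ = 1) ∧
      (∀ i k, lam i = μ → lam k = μ → i ≠ k → inner ℝ (ψ i) (ψ k) = 0) ∧
      ∀ v, (∀ i, lam i = μ → inner ℝ (ψ i) v = 0) → v ∈ (eigenspace (T : E →ₗ[ℝ] E) μ)ᗮ := by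
  classical
  have hfin : FiniteDimensional ℝ (eigenspace (T : E →ₗ[ℝ] E) μ) :=
    T.finite_dimensional_eigenspace hT μ hμ
  have hcard := hlam.encard_eq μ hμ
  rw [← Module.finrank_eq_rank, map_natCast] at hcard
  have hfs : {i | lam i = μ}.Finite := Set.finite_of_encard_eq_coe hcard
  have := hfs.fintype
  have hc : Fintype.card {i | lam i = μ} = Module.finrank ℝ (eigenspace (T : E →ₗ[ℝ] E) μ) := by
    rw [← Nat.card_eq_fintype_card]
    have h := hfs.cast_ncard_eq
    rw [hcard] at h
    exact_mod_cast h
  let b := (stdOrthonormalBasis ℝ (eigenspace (T : E →ₗ[ℝ] E) μ)).reindex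
    (finCongr hc.symm |>.trans (Fintype.equivFin {i | lam i = μ}).symm)
  refine ⟨fun i => if h : lam i = μ then (b ⟨i, h⟩ : E) else 0, ?_, ?_, ?_⟩
  · intro i hi
    simp only [hi, dite_true]
    refine ⟨mem_eigenspace_iff.1 (b ⟨i, hi⟩).2, ?_⟩
    exact b.orthonormal.1 _
  · intro i k hi hk hik
    simp only [hi, hk, dite_true]
    have := b.orthonormal.2 (i := ⟨i, hi⟩) (j := ⟨k, hk⟩) (fun h => hik (congrArg Subtype.val h))
    exact this
  · intro v hv
    rw [Submodule.mem_orthogonal]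
    intro u hu
    have hrep := b.sum_repr ⟨u, hu⟩
    have hu' : u = ∑ i, b.repr ⟨u, hu⟩ i • (b i : E) := by
      have := congrArg Subtype.val hrep
      simpa using this.symm
    rw [hu', sum_inner]
    refine Finset.sum_eq_zero fun i _ => ?_
    have := hv i i.2
    simp only [show lam i = μ from i.2, dite_true] at this
    rw [real_inner_smul_left, this, mul_zero]

open Module.End in
/-- An eigenvalue sequence of a compact self-adjoint operator is realized by orthonormal
eigenvectors whose orthogonal complement is contained in the kernel. -/
theorem exists_eigenvector_sequence {T : E →L[ℝ] E} (hT : IsCompactOperator T)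
    (hsymm : (T : E →ₗ[ℝ] E).IsSymmetric) {lam : ℕ → ℝ}
    (hlam : IsEigenvalueSequence (T : E →ₗ[ℝ] E) lam) :
    ∃ φ : ℕ → E, IsPartialOrthonormal φ ∧ (∀ i, T (φ i) = lam i • φ i) ∧
      (∀ i, lam i ≠ 0 → ‖φ i‖ = 1) ∧ (∀ i, lam i = 0 → φ i = 0) ∧
      ∀ v, (∀ i, inner ℝ (φ i) v = 0) → T v = 0 := by
  classical
  choose ψ h1 h2 h3 using fun (μ : ℝ) (hμ : μ ≠ 0) =>
    exists_orthonormal_basis_eigenspace hT hlam hμ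
  let φ : ℕ → E := fun i => if h : lam i ≠ 0 then ψ (lam i) h i else 0
  have hφ : ∀ i (h : lam i ≠ 0), φ i = ψ (lam i) h i := fun i h => dif_pos h
  have hφ0 : ∀ i, lam i = 0 → φ i = 0 := fun i h => dif_neg (not_not.2 h)
  have hφ1 : ∀ i, lam i ≠ 0 → ‖φ i‖ = 1 := fun i h => by
    rw [hφ i h]; exact (h1 _ h i rfl).2
  have hTφ : ∀ i, T (φ i) = lam i • φ i := fun i => by
    by_cases h : lam i = 0
    · rw [hφ0 i h, map_zero, smul_zero]
    · rw [hφ i h]; exact (h1 _ h i rfl).1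
  refine ⟨φ, ⟨fun i k hik => ?_, fun i => ?_⟩, hTφ, hφ1, hφ0, fun v hv => ?_⟩
  · by_cases hlk : lam i = lam k
    · by_cases h : lam i = 0
      · rw [hφ0 i h, inner_zero_left]
      · have hk : φ k = ψ (lam i) h k := by
          rw [hφ k (hlk ▸ h)]; congr 1; simp only [hlk]
        rw [hφ i h, hk]
        exact h2 _ h i k rfl hlk.symm hik
    · have := hsymm (φ i) (φ k)
      simp only [ContinuousLinearMap.coe_coe, hTφ, real_inner_smul_left,
        real_inner_smul_right] at this
      have h0 : (lam i - lam k) * inner ℝ (φ i) (φ k) = 0 := by linarith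
      exact (mul_eq_zero.1 h0).resolve_left (sub_ne_zero.2 hlk)
  · by_cases h : lam i = 0
    · exact Or.inl (hφ0 i h)
    · exact Or.inr (hφ1 i h)
  -- For `μ = 0` the range of a symmetric operator is orthogonal to its kernel. For `μ ≠ 0` the
  -- vector `v` is already orthogonal to the eigenspace, and the complement is invariant. The
  -- spectral theorem then forces `T v = 0`.
  · have hmem : ∀ μ, T v ∈ (eigenspace (T : E →ₗ[ℝ] E) μ)ᗮ := by
      intro μ
      by_cases hμ : μ = 0
      · rw [Submodule.mem_orthogonal]
        intro u hu
        rw [mem_eigenspace_iff, hμ, zero_smul] at hu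
        have := hsymm u v
        rw [hu, inner_zero_left] at this
        exact this.symm
      · refine hsymm.invariant_orthogonalComplement_eigenspace μ v (h3 μ hμ v fun i hi => ?_)
        have := hv i
        subst hi
        rwa [hφ i hμ] at this
    have hbot := T.orthogonalComplement_iSup_eigenspaces_eq_bot hT hsymm
    rw [← Submodule.iInf_orthogonal] at hbot
    have : T v ∈ (⨅ μ, (eigenspace (T : E →ₗ[ℝ] E) μ)ᗮ) := (Submodule.mem_iInf _).2 hmem
    rw [hbot] at this
    exact (Submodule.mem_bot ℝ).1 this

/-- The singular value decomposition of `J` from an eigenvalue sequence of `J J†`. -/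
theorem exists_singular_vectors {G : Type*} [NormedAddCommGroup G] [InnerProductSpace ℝ G]
    [CompleteSpace G] {J : G →L[ℝ] E} (hJ : IsCompactOperator J) {lam : ℕ → ℝ}
    (hlam : IsEigenvalueSequence ((J ∘L J.adjoint : E →L[ℝ] E) : E →ₗ[ℝ] E) lam) :
    (∀ i, 0 ≤ lam i) ∧ ∃ e : ℕ → G, IsPartialOrthonormal e ∧
      (∀ i, ‖J (e i)‖ ^ 2 = lam i) ∧
      (∀ g (s : Finset ℕ), ∑ i ∈ s, lam i * inner ℝ (e i) g ^ 2 ≤ ‖J g‖ ^ 2) ∧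
      (∀ i, lam i = 0 → e i = 0) ∧
      ∀ g, (∀ i, inner ℝ (e i) g = 0) → J g = 0 := by
  have hsymm : ((J ∘L J.adjoint : E →L[ℝ] E) : E →ₗ[ℝ] E).IsSymmetric := by
    intro u v
    simp [← ContinuousLinearMap.adjoint_inner_right]
  obtain ⟨φ, hφ, hT, h1, h0, hker⟩ := exists_eigenvector_sequence (hJ.comp_clm _) hsymm hlam
  have hnorm : ∀ i, ‖J.adjoint (φ i)‖ ^ 2 = lam i := by
    intro i
    rw [← real_inner_self_eq_norm_sq, ContinuousLinearMap.adjoint_inner_right]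
    have h := hT i
    rw [ContinuousLinearMap.comp_apply] at h
    rw [h, real_inner_smul_left, real_inner_self_eq_norm_sq]
    by_cases hi : lam i = 0
    · simp [hi]
    · simp [h1 i hi]
  have hpos : ∀ i, 0 ≤ lam i := fun i => hnorm i ▸ sq_nonneg _
  have hJe : ∀ i, J ((√(lam i))⁻¹ • J.adjoint (φ i)) = √(lam i) • φ i := by
    intro i
    have h := hT i
    rw [ContinuousLinearMap.comp_apply] at h
    rw [map_smul, h, smul_smul]
    congr 1
    by_cases hi : lam i = 0
    · simp [hi]
    · have : √(lam i) ≠ 0 := Real.sqrt_ne_zero'.2 (lt_of_le_of_ne (hpos i) (Ne.symm hi))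
      field_simp
      exact (Real.sq_sqrt (hpos i)).symm
  have hinner : ∀ i g, √(lam i) * inner ℝ ((√(lam i))⁻¹ • J.adjoint (φ i)) g
      = inner ℝ (φ i) (J g) := by
    intro i g
    rw [real_inner_smul_left, ContinuousLinearMap.adjoint_inner_left]
    by_cases hi : lam i = 0
    · simp [hi, h0 i hi]
    · have : √(lam i) ≠ 0 := Real.sqrt_ne_zero'.2 (lt_of_le_of_ne (hpos i) (Ne.symm hi))
      field_simp
  -- With the convention 0⁻¹ = 0 this vector is zero exactly where the eigenvalue is.
  refine ⟨hpos, fun i => (√(lam i))⁻¹ • J.adjoint (φ i), ⟨fun i k hik => ?_, fun i => ?_⟩,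
    fun i => ?_, fun g s => ?_, fun i hi => ?_, fun g hg => ?_⟩
  · rw [real_inner_smul_left, ContinuousLinearMap.adjoint_inner_left, hJe, real_inner_smul_right,
      hφ.inner_eq_zero i k hik]
    simp
  · by_cases hi : lam i = 0
    · left; simp [hi]
    · right
      have hs : √(lam i) ≠ 0 := Real.sqrt_ne_zero'.2 (lt_of_le_of_ne (hpos i) (Ne.symm hi))
      have hn : ‖J.adjoint (φ i)‖ = √(lam i) := by
        rw [← hnorm i, Real.sqrt_sq (norm_nonneg _)]
      rw [norm_smul, hn, norm_inv, Real.norm_of_nonneg (Real.sqrt_nonneg _), inv_mul_cancel₀ hs]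
  · rw [hJe, norm_smul, mul_pow, Real.norm_of_nonneg (Real.sqrt_nonneg _), Real.sq_sqrt (hpos i)]
    by_cases hi : lam i = 0
    · simp [hi]
    · simp [h1 i hi]
  · refine le_trans (le_of_eq ?_) (hφ.sum_inner_sq_le s (J g))
    refine Finset.sum_congr rfl fun i _ => ?_
    rw [← hinner, mul_pow, Real.sq_sqrt (hpos i)]
  · simp [hi]
  -- Both factors are peeled off by ‖J†u‖² = ⟨u, J J†u⟩ and ‖J g‖² = ⟨g, J†J g⟩.
  · have hz : J (J.adjoint (J g)) = 0 := hker (J g) fun i => by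
      rw [← hinner, hg i, mul_zero]
    have hz2 : J.adjoint (J g) = 0 := by
      rw [← inner_self_eq_zero (𝕜 := ℝ), ContinuousLinearMap.adjoint_inner_right, hz,
        inner_zero_left]
    rw [← inner_self_eq_zero (𝕜 := ℝ), ← ContinuousLinearMap.adjoint_inner_right, hz2,
      inner_zero_right]

end EigenvalueSequence

/-! ### The embedding into L²(ρ) induced by a feature map -/

section Embedding

variable {X : Type*} [MeasurableSpace X] {E : Type*} [NormedAddCommGroup E] [InnerProductSpace ℝ E]

/-- The bilinear map sending `g` and `Φ` to the function `x ↦ ⟪g, Φ x⟫` in `L²(ρ)`. -/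
noncomputable def innerLp (ρ : Measure X) : E →L[ℝ] Lp E 2 ρ →L[ℝ] Lp ℝ 2 ρ :=
  LinearMap.mkContinuous₂
    (LinearMap.mk₂ ℝ (fun g Φ => (innerSL ℝ g).compLp Φ)
      (fun g g' Φ => by rw [map_add, ContinuousLinearMap.add_compLp])
      (fun c g Φ => by
        rw [map_smul]
        simp [ContinuousLinearMap.smul_compLp])
      (fun g Φ Φ' => ((innerSL ℝ g).compLpL 2 ρ).map_add Φ Φ')
      (fun c g Φ => ((innerSL ℝ g).compLpL 2 ρ).map_smul c Φ)) 1
    (fun g Φ => by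
      rw [one_mul]
      change ‖(innerSL ℝ g).compLp Φ‖ ≤ ‖g‖ * ‖Φ‖
      refine ((innerSL ℝ g).norm_compLp_le Φ).trans_eq ?_
      rw [innerSL_apply_norm])

theorem coeFn_innerLp (ρ : Measure X) (g : E) (Φ : Lp E 2 ρ) :
    innerLp ρ g Φ =ᵐ[ρ] fun x => inner ℝ g (Φ x) :=
  (innerSL ℝ g).coeFn_compLp Φ

theorem isCompactOperator_innerLp_indicatorConstLp (ρ : Measure X) {s : Set X}
    (hs : MeasurableSet s) (hμs : ρ s ≠ ⊤) (c : E) :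
    IsCompactOperator ((innerLp ρ).flip (indicatorConstLp 2 hs hμs c)) := by
  have h : (innerLp ρ).flip (indicatorConstLp 2 hs hμs c)
      = (ContinuousLinearMap.toSpanSingleton ℝ (indicatorConstLp 2 hs hμs (1 : ℝ)))
        ∘L (innerSL ℝ c) := by
    ext1 g
    rw [ContinuousLinearMap.flip_apply, ContinuousLinearMap.comp_apply,
      ContinuousLinearMap.toSpanSingleton_apply, innerSL_apply_apply]
    refine Lp.ext ?_
    filter_upwards [coeFn_innerLp ρ g (indicatorConstLp 2 hs hμs c),
      indicatorConstLp_coeFn (p := 2) (hs := hs) (hμs := hμs) (c := c),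
      indicatorConstLp_coeFn (p := 2) (hs := hs) (hμs := hμs) (c := (1 : ℝ)),
      Lp.coeFn_smul (inner ℝ c g) (indicatorConstLp 2 hs hμs (1 : ℝ))] with x h1 h2 h3 h4
    rw [h1, h2, h4, Pi.smul_apply, h3]
    by_cases hx : x ∈ s <;> simp [hx, real_inner_comm]
  rw [h]
  exact (isCompactOperator_of_locallyCompactSpace_rng
    (ContinuousLinearMap.toSpanSingleton ℝ (indicatorConstLp 2 hs hμs (1 : ℝ)))).comp_clm _

/-- Indicator features give rank-one operators, their sums are dense in L², and compactness survives
limits in operator norm because the operator depends continuously on `Φ`. -/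
theorem isCompactOperator_innerLp (ρ : Measure X) (Φ : Lp E 2 ρ) :
    IsCompactOperator ((innerLp ρ).flip Φ) := by
  let A : Lp E 2 ρ →L[ℝ] E →L[ℝ] Lp ℝ 2 ρ := (innerLp ρ).flip
  have hcl : IsClosed {B : E →L[ℝ] Lp ℝ 2 ρ | IsCompactOperator B} :=
    isClosed_setOfPred_isCompactOperator
  have hA : Continuous A := A.continuous
  have hadd : ∀ f g, IsCompactOperator (A f) → IsCompactOperator (A g) →
      IsCompactOperator (A (f + g)) := fun f g hf hg => by
    rw [map_add]
    exact hf.add hg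
  have hind : ∀ (c : E) {s : Set X} (hs : MeasurableSet s) (hμs : ρ s ≠ ⊤),
      IsCompactOperator (A (indicatorConstLp 2 hs hμs c)) := fun c _ hs hμs =>
    isCompactOperator_innerLp_indicatorConstLp ρ hs hμs c
  change IsCompactOperator (A Φ)
  clear_value A
  refine Lp.induction (E := E) (μ := ρ) (p := 2) ENNReal.ofNat_ne_top
    (fun Φ => IsCompactOperator (A Φ)) ?_ ?_ ?_ Φ
  · intro c s hs hμs
    rw [Lp.simpleFunc.coe_indicatorConst]
    exact hind c hs hμs.ne
  · exact fun f g hf hg _ h1 h2 => hadd _ _ h1 h2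
  · exact hcl.preimage hA

/-- The map `g ↦ (x ↦ ⟪g, Φ x⟫)` into `L²(ρ)` given by a square integrable feature map `Φ`. -/
noncomputable def featureEmbedding (ρ : Measure X) {Φ : X → E} (hΦ : MemLp Φ 2 ρ) :
    E →L[ℝ] Lp ℝ 2 ρ :=
  (innerLp ρ).flip (hΦ.toLp Φ)

variable {ρ : Measure X} {Φ : X → E} (hΦ : MemLp Φ 2 ρ)

theorem coeFn_featureEmbedding (g : E) :
    featureEmbedding ρ hΦ g =ᵐ[ρ] fun x => inner ℝ g (Φ x) := by
  filter_upwards [coeFn_innerLp ρ g (hΦ.toLp Φ), hΦ.coeFn_toLp] with x h1 h2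
  rw [← h2]; exact h1

theorem norm_featureEmbedding_sq (g : E) :
    ‖featureEmbedding ρ hΦ g‖ ^ 2 = ∫ x, inner ℝ g (Φ x) ^ 2 ∂ρ := by
  rw [← real_inner_self_eq_norm_sq, L2.inner_def]
  refine integral_congr_ae ?_
  filter_upwards [coeFn_featureEmbedding hΦ g] with x hx
  rw [hx]; simp [sq]

theorem integralOperator_eq_comp_adjoint [CompleteSpace E] [IsProbabilityMeasure ρ]
    {k : X → X → ℝ} (hk : MemLp (fun p : X × X => k p.1 p.2) 2 (ρ.prod ρ))
    (hkΦ : ∀ x y, k x y = inner ℝ (Φ x) (Φ y)) :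
    integralOperator ρ k hk = ((featureEmbedding ρ hΦ ∘L (featureEmbedding ρ hΦ).adjoint :
      Lp ℝ 2 ρ →L[ℝ] Lp ℝ 2 ρ) : Lp ℝ 2 ρ →ₗ[ℝ] Lp ℝ 2 ρ) := by
  ext1 f
  refine Lp.ext ?_
  rw [ContinuousLinearMap.coe_coe, ContinuousLinearMap.comp_apply]
  filter_upwards [(memLp_integralTransform hk f).coeFn_toLp,
    coeFn_featureEmbedding hΦ ((featureEmbedding ρ hΦ).adjoint f)] with x h1 h2
  rw [h2, ContinuousLinearMap.adjoint_inner_left, L2.inner_def]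
  refine h1.trans (integral_congr_ae ?_)
  filter_upwards [coeFn_featureEmbedding hΦ (Φ x)] with y hy
  rw [hy, hkΦ]
  simp

/-- The point is to choose one null set for all `c`, although `E` need not be separable. Strong
measurability confines the projection of `Φ` onto the orthogonal complement of the family to a
separable set almost surely, and there testing against each functional separately suffices. -/
theorem ae_inner_eq_zero_of_orthogonal [CompleteSpace E] (hΦ : AEStronglyMeasurable Φ ρ)
    {ι : Type*} {e : ι → E}
    (he : ∀ c, (∀ i, inner ℝ (e i) c = 0) → ∀ᵐ x ∂ρ, inner ℝ c (Φ x) = 0) :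
    ∀ᵐ x ∂ρ, ∀ c, (∀ i, inner ℝ (e i) c = 0) → inner ℝ c (Φ x) = 0 := by
  let K : Submodule ℝ E := (Submodule.span ℝ (Set.range e))ᗮ
  have hK : ∀ c, c ∈ K ↔ ∀ i, inner ℝ (e i) c = 0 := by
    intro c
    rw [Submodule.mem_orthogonal]
    constructor
    · exact fun h i => h _ (Submodule.subset_span ⟨i, rfl⟩)
    · intro h u hu
      induction hu using Submodule.span_induction with
      | mem x hx => obtain ⟨i, rfl⟩ := hx; exact h i
      | zero => exact inner_zero_left _
      | add x y _ _ hx hy => rw [inner_add_left, hx, hy, add_zero]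
      | smul a x _ hx => rw [real_inner_smul_left, hx, mul_zero]
  have hPm : AEStronglyMeasurable (fun x => K.starProjection (Φ x)) ρ :=
    K.starProjection.continuous.comp_aestronglyMeasurable hΦ
  obtain ⟨t, ht, htΦ⟩ := hPm.isSeparable_ae_range
  have hz : (fun x => K.starProjection (Φ x)) =ᵐ[ρ] 0 := by
    refine ae_eq_zero_of_forall_dual_of_isSeparable ℝ ht (fun c => ?_) htΦ
    obtain ⟨w, rfl⟩ := (InnerProductSpace.toDual ℝ E).surjective c
    filter_upwards [he (K.starProjection w) ((hK _).1 (K.starProjection_apply_mem w))] with x hx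
    rw [InnerProductSpace.toDual_apply_apply, ← Submodule.inner_starProjection_left_eq_right, hx]
    rfl
  filter_upwards [hz] with x hx c hc
  have hcK : K.starProjection c = c := Submodule.starProjection_eq_self_iff.2 ((hK c).2 hc)
  rw [← hcK, Submodule.inner_starProjection_left_eq_right]
  simp only [Pi.zero_apply] at hx
  rw [hx, inner_zero_right]

end Embedding

/-! ### The trace formula and its tails -/

section Mercer

variable {X : Type*} [MeasurableSpace X] {E : Type*} [NormedAddCommGroup E] [InnerProductSpace ℝ E]
  {ρ : Measure X} {Φ : X → E}

/-- Eigenvectors of the covariance operator of a feature map, and the trace formula. -/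
theorem exists_covariance_eigenvectors [CompleteSpace E] [IsProbabilityMeasure ρ] (hΦ : MemLp Φ 2 ρ)
    {k : X → X → ℝ} (hk : MemLp (fun p : X × X => k p.1 p.2) 2 (ρ.prod ρ))
    (hkΦ : ∀ x y, k x y = inner ℝ (Φ x) (Φ y)) {lam : ℕ → ℝ}
    (hlam : IsEigenvalueSequence (integralOperator ρ k hk) lam) :
    (∀ i, 0 ≤ lam i) ∧ HasSum lam (∫ x, ‖Φ x‖ ^ 2 ∂ρ) ∧
      ∃ e : ℕ → E, IsPartialOrthonormal e ∧ (∀ i, lam i = 0 → e i = 0) ∧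
      (∀ i, ∫ x, inner ℝ (e i) (Φ x) ^ 2 ∂ρ = lam i) ∧
      (∀ g (s : Finset ℕ), ∑ i ∈ s, lam i * inner ℝ (e i) g ^ 2
        ≤ ∫ x, inner ℝ g (Φ x) ^ 2 ∂ρ) := by
  rw [integralOperator_eq_comp_adjoint hΦ hk hkΦ] at hlam
  obtain ⟨hpos, e, he, hJ, hb, h0, hker⟩ :=
    exists_singular_vectors (isCompactOperator_innerLp ρ (hΦ.toLp Φ)) hlam
  have hint : ∀ i, ∫ x, inner ℝ (e i) (Φ x) ^ 2 ∂ρ = lam i := fun i => by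
    rw [← norm_featureEmbedding_sq hΦ, ← hJ i]; rfl
  refine ⟨hpos, ?_, e, he, h0, hint, fun g s => ?_⟩
  · have hae := ae_inner_eq_zero_of_orthogonal hΦ.1 (e := e) fun c hc => by
      have hz : featureEmbedding ρ hΦ c = 0 := hker c hc
      filter_upwards [coeFn_featureEmbedding hΦ c, Lp.coeFn_zero ℝ 2 ρ] with x h1 h2
      rw [hz, h2] at h1
      exact h1.symm
    have hI : ∀ i, Integrable (fun x => inner ℝ (e i) (Φ x) ^ 2) ρ := fun i =>
      (hΦ.const_inner (e i)).integrable_sq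
    have hn : Integrable (fun x => ‖Φ x‖ ^ 2) ρ := (memLp_two_iff_integrable_sq_norm hΦ.1).1 hΦ
    have hsummable : Summable lam := by
      refine summable_of_sum_range_le (c := ∫ x, ‖Φ x‖ ^ 2 ∂ρ) hpos fun m => ?_
      simp_rw [← hint]
      rw [← integral_finsetSum _ fun i _ => hI i]
      exact integral_mono (integrable_finsetSum _ fun i _ => hI i) hn
        fun x => he.sum_inner_sq_le _ _
    -- Summability, just obtained from Bessel, permits exchanging sum and integral; Parseval then
    -- identifies the summed integrand with ‖Φ‖² almost everywhere.
    have h := hasSum_integral_of_summable_integral_norm (μ := ρ)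
      (F := fun (i : ℕ) x => (inner ℝ (e i) (Φ x) : ℝ) ^ 2)
      hI (by simpa [hint] using hsummable)
    simp only [hint] at h
    have heq : ∫ x, ‖Φ x‖ ^ 2 ∂ρ = ∫ x, ∑' i, inner ℝ (e i) (Φ x) ^ 2 ∂ρ := by
      refine integral_congr_ae ?_
      filter_upwards [hae] with x hx
      exact (he.hasSum_inner_sq hx).tsum_eq.symm
    rw [heq]
    exact h
  · rw [← norm_featureEmbedding_sq hΦ]
    exact hb g s

/-- The part of the trace that is left after removing finitely many eigenvectors. -/
theorem integral_norm_sub_sum_sq (hΦ : MemLp Φ 2 ρ) {e : ℕ → E} (he : IsPartialOrthonormal e)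
    {lam : ℕ → ℝ} (hint : ∀ i, ∫ x, inner ℝ (e i) (Φ x) ^ 2 ∂ρ = lam i)
    (hsum : HasSum lam (∫ x, ‖Φ x‖ ^ 2 ∂ρ)) (j : ℕ) :
    ∫ x, ‖Φ x - ∑ i ∈ Finset.range j, inner ℝ (e i) (Φ x) • e i‖ ^ 2 ∂ρ
      = ∑' i, lam (j + i) := by
  simp_rw [he.norm_sub_sum_sq]
  have hI : ∀ i, Integrable (fun x => inner ℝ (e i) (Φ x) ^ 2) ρ := fun i =>
    (hΦ.const_inner (e i)).integrable_sq
  have hn : Integrable (fun x => ‖Φ x‖ ^ 2) ρ := (memLp_two_iff_integrable_sq_norm hΦ.1).1 hΦ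
  rw [integral_sub hn (integrable_finsetSum _ fun i _ => hI i),
    integral_finsetSum _ fun i _ => hI i, ← hsum.tsum_eq,
    ← hsum.summable.sum_add_tsum_nat_add j]
  simp_rw [hint, add_comm j]
  ring

end Mercer

/-! ### Moments of random signs -/

section Signs

variable {n : ℕ}

theorem sum_signs_mul (i k : Fin n) :
    ∑ σ : Fin n → ℤˣ, ((σ i : ℤ) : ℝ) * ((σ k : ℤ) : ℝ) = if i = k then 2 ^ n else 0 := by
  split_ifs with h
  · subst h
    have : ∀ σ : Fin n → ℤˣ, ((σ i : ℤ) : ℝ) * ((σ i : ℤ) : ℝ) = 1 := fun σ => by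
      rcases Int.units_eq_one_or (σ i) with h | h <;> simp [h]
    simp [this]
  -- Flipping only the sign at `i` permutes the sign vectors and negates the summand, so the sum
  -- equals its own negative.
  · let τ : Fin n → ℤˣ := Function.update 1 i (-1)
    have hs := Equiv.sum_comp (Equiv.mulLeft τ)
      (fun σ : Fin n → ℤˣ => ((σ i : ℤ) : ℝ) * ((σ k : ℤ) : ℝ))
    have hneg : ∀ σ : Fin n → ℤˣ, (((Equiv.mulLeft τ σ) i : ℤ) : ℝ)
        * (((Equiv.mulLeft τ σ) k : ℤ) : ℝ) = -(((σ i : ℤ) : ℝ) * ((σ k : ℤ) : ℝ)) := by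
      intro σ
      have h1 : τ i = -1 := Function.update_self i (-1) 1
      have h2 : τ k = 1 := Function.update_of_ne (Ne.symm h) (-1) 1
      simp [Equiv.coe_mulLeft, h1, h2]
    simp only [hneg, Finset.sum_neg_distrib] at hs
    linarith

theorem sum_signs (i : Fin n) : ∑ σ : Fin n → ℤˣ, ((σ i : ℤ) : ℝ) = 0 := by
  let τ : Fin n → ℤˣ := fun _ => -1
  have hs := Equiv.sum_comp (Equiv.mulLeft τ) (fun σ : Fin n → ℤˣ => ((σ i : ℤ) : ℝ))
  simp only [Equiv.coe_mulLeft, Pi.mul_apply, τ] at hs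
  simp only [neg_mul, one_mul, Units.val_neg, Int.cast_neg, Finset.sum_neg_distrib] at hs
  linarith

theorem card_signs : ((Finset.univ : Finset (Fin n → ℤˣ)).card : ℝ) = 2 ^ n := by
  simp

theorem sum_signs_sum_mul (c : Fin n → ℝ) :
    ∑ σ : Fin n → ℤˣ, ∑ i, ((σ i : ℤ) : ℝ) * c i = 0 := by
  rw [Finset.sum_comm]
  refine Finset.sum_eq_zero fun i _ => ?_
  rw [← Finset.sum_mul, sum_signs, zero_mul]

variable {E : Type*} [NormedAddCommGroup E] [InnerProductSpace ℝ E]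

theorem sum_signs_norm_sq (v : Fin n → E) :
    ∑ σ : Fin n → ℤˣ, ‖∑ i, ((σ i : ℤ) : ℝ) • v i‖ ^ 2 = 2 ^ n * ∑ i, ‖v i‖ ^ 2 := by
  have h : ∀ σ : Fin n → ℤˣ, ‖∑ i, ((σ i : ℤ) : ℝ) • v i‖ ^ 2
      = ∑ i, ∑ k, ((σ i : ℤ) : ℝ) * ((σ k : ℤ) : ℝ) * inner ℝ (v i) (v k) := by
    intro σ
    rw [← real_inner_self_eq_norm_sq, sum_inner]
    refine Finset.sum_congr rfl fun i _ => ?_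
    rw [inner_sum]
    refine Finset.sum_congr rfl fun k _ => ?_
    rw [real_inner_smul_left, real_inner_smul_right, mul_assoc]
  simp_rw [h]
  rw [Finset.sum_comm, Finset.mul_sum]
  refine Finset.sum_congr rfl fun i _ => ?_
  rw [Finset.sum_comm]
  simp_rw [← Finset.sum_mul, sum_signs_mul]
  simp

/-- Jensen's inequality, in the form of Cauchy–Schwarz over the 2ⁿ sign vectors; the mixed terms of
the second moment cancel. -/
theorem average_signs_norm_le (v : Fin n → E) :
    (2 ^ n : ℝ)⁻¹ * ∑ σ : Fin n → ℤˣ, ‖∑ i, ((σ i : ℤ) : ℝ) • v i‖ ≤ √(∑ i, ‖v i‖ ^ 2) := by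
  have hN : (0 : ℝ) < 2 ^ n := by positivity
  refine Real.le_sqrt_of_sq_le ?_
  have h := sq_sum_le_card_mul_sum_sq (s := (Finset.univ : Finset (Fin n → ℤˣ)))
    (f := fun σ => ‖∑ i, ((σ i : ℤ) : ℝ) • v i‖)
  rw [sum_signs_norm_sq, card_signs] at h
  rw [mul_pow]
  calc ((2 ^ n : ℝ)⁻¹) ^ 2 * (∑ σ : Fin n → ℤˣ, ‖∑ i, ((σ i : ℤ) : ℝ) • v i‖) ^ 2
      ≤ ((2 ^ n : ℝ)⁻¹) ^ 2 * (2 ^ n * (2 ^ n * ∑ i, ‖v i‖ ^ 2)) := by gcongr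
    _ = ∑ i, ‖v i‖ ^ 2 := by field_simp

end Signs

/-! ### Suprema of bounded linear functionals -/

section Supremum

variable {E : Type*} [NormedAddCommGroup E] [InnerProductSpace ℝ E] {ι : Type*} {g : ι → E} {H : ℝ}

theorem inner_le_of_norm_le (hg : ∀ i, ‖g i‖ ≤ H) (i : ι) (v : E) : inner ℝ (g i) v ≤ H * ‖v‖ :=
  (real_inner_le_norm _ _).trans (mul_le_mul_of_nonneg_right (hg i) (norm_nonneg _))

theorem bddAbove_range_inner (hg : ∀ i, ‖g i‖ ≤ H) (v : E) :
    BddAbove (Set.range fun i => inner ℝ (g i) v) :=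
  ⟨H * ‖v‖, by rintro _ ⟨i, rfl⟩; exact inner_le_of_norm_le hg i v⟩

theorem iSup_inner_sub_le [Nonempty ι] (hg : ∀ i, ‖g i‖ ≤ H) (v w : E) :
    (⨆ i, inner ℝ (g i) v) ≤ (⨆ i, inner ℝ (g i) w) + H * ‖v - w‖ := by
  refine ciSup_le fun i => ?_
  have h1 := le_ciSup (bddAbove_range_inner hg w) i
  have h2 := inner_le_of_norm_le hg i (v - w)
  rw [inner_sub_right] at h2
  linarith

/-- A supremum of `H`-Lipschitz functions is `H`-Lipschitz. This supplies measurability for classes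
of any cardinality. -/
theorem continuous_iSup_inner [Nonempty ι] (hg : ∀ i, ‖g i‖ ≤ H) :
    Continuous fun v => ⨆ i, inner ℝ (g i) v := by
  have hH : 0 ≤ H := (norm_nonneg _).trans (hg (Classical.arbitrary ι))
  refine (LipschitzWith.of_dist_le_mul (K := ⟨H, hH⟩) fun v w => ?_).continuous
  rw [Real.dist_eq, dist_eq_norm, abs_sub_le_iff]
  have h1 := iSup_inner_sub_le hg v w
  have h2 := iSup_inner_sub_le hg w v
  rw [norm_sub_rev] at h2
  change _ ≤ H * _ ∧ _ ≤ H * _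
  constructor <;> linarith

theorem abs_iSup_inner_le [Nonempty ι] (hg : ∀ i, ‖g i‖ ≤ H) (v : E) :
    |⨆ i, inner ℝ (g i) v| ≤ H * ‖v‖ := by
  rw [abs_le]
  have h1 := iSup_inner_sub_le hg v 0
  have h2 := iSup_inner_sub_le hg 0 v
  simp at h1 h2
  constructor <;> linarith

end Supremum

/-! ### Rademacher complexity over an i.i.d. sample -/

section Sample

variable {X : Type*} [MeasurableSpace X] {ρ : Measure X} [IsProbabilityMeasure ρ] {n : ℕ}
  {E : Type*} [NormedAddCommGroup E]

theorem integral_pi_eval (f : X → ℝ) (i : Fin n) (hf : AEStronglyMeasurable f ρ) :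
    ∫ x : Fin n → X, f (x i) ∂(Measure.pi fun _ => ρ) = ∫ x, f x ∂ρ := by
  have h := (measurePreserving_eval (fun _ : Fin n => ρ) i)
  have h2 := integral_map (f := f) (h.measurable.aemeasurable) (by rw [h.map_eq]; exact hf)
  rw [h.map_eq] at h2
  exact h2.symm

theorem integrable_pi_eval {f : X → ℝ} (i : Fin n) (hf : Integrable f ρ) :
    Integrable (fun x : Fin n → X => f (x i)) (Measure.pi fun _ => ρ) :=
  (measurePreserving_eval (fun _ : Fin n => ρ) i).integrable_comp_of_integrable hf

theorem integral_sqrt_le {Ω : Type*} [MeasurableSpace Ω] {μ : Measure Ω} [IsProbabilityMeasure μ]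
    {f : Ω → ℝ} (hf0 : ∀ x, 0 ≤ f x) (hf : Integrable f μ) :
    Integrable (fun x => √(f x)) μ ∧ ∫ x, √(f x) ∂μ ≤ √(∫ x, f x ∂μ) := by
  have hm : AEStronglyMeasurable (fun x => √(f x)) μ :=
    Real.continuous_sqrt.comp_aestronglyMeasurable hf.1
  have h2 : MemLp (fun x => √(f x)) 2 μ := by
    rw [memLp_two_iff_integrable_sq hm]
    simpa only [Real.sq_sqrt (hf0 _)] using hf
  refine ⟨h2.integrable (by norm_num), Real.le_sqrt_of_sq_le ?_⟩
  have h := sq_integral_mul_le h2 (memLp_const (1 : ℝ))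
  simpa [Real.sq_sqrt (hf0 _)] using h

theorem integral_average_norm_le {U : X → E} (hU : MemLp U 2 ρ) :
    Integrable (fun x : Fin n → X => √(∑ i, ‖U (x i)‖ ^ 2)) (Measure.pi fun _ => ρ) ∧
    ∫ x : Fin n → X, √(∑ i, ‖U (x i)‖ ^ 2) ∂(Measure.pi fun _ => ρ)
      ≤ √(n * ∫ x, ‖U x‖ ^ 2 ∂ρ) := by
  have hI : Integrable (fun x => ‖U x‖ ^ 2) ρ := (memLp_two_iff_integrable_sq_norm hU.1).1 hU
  have hIs : ∀ i : Fin n, Integrable (fun x : Fin n → X => ‖U (x i)‖ ^ 2)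
      (Measure.pi fun _ => ρ) := fun i => integrable_pi_eval (f := fun x => ‖U x‖ ^ 2) i hI
  have h := integral_sqrt_le (μ := Measure.pi fun _ : Fin n => ρ)
    (f := fun x => ∑ i, ‖U (x i)‖ ^ 2) (fun x => Finset.sum_nonneg fun i _ => sq_nonneg _)
    (integrable_finsetSum _ fun i _ => hIs i)
  rw [integral_finsetSum _ fun i _ => hIs i] at h
  simp_rw [fun i : Fin n => integral_pi_eval (ρ := ρ) (fun x => ‖U x‖ ^ 2) i hI.1] at h
  simpa using h

variable [InnerProductSpace ℝ E] {Φ : X → E} {F : Set (X → ℝ)} {H : ℝ}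

/-- For fixed signs the supremum depends on the sample only through one vector of `E`, and does so
continuously and with at most linear growth. -/
theorem integrable_empiricalRademacher (hΦ : MemLp Φ 2 ρ) (hne : F.Nonempty)
    (hF : ∀ f ∈ F, ∃ g : E, ‖g‖ ≤ H ∧ ∀ x, f x = inner ℝ g (Φ x)) :
    Integrable (fun x : Fin n → X => empiricalRademacher F x) (Measure.pi fun _ => ρ) := by
  have : Nonempty F := hne.to_subtype
  choose g hg hgf using fun f : F => hF f f.2
  have hv : ∀ (σ : Fin n → ℤˣ), Integrable (fun x : Fin n → X =>
      (1 / (n : ℝ)) • ∑ i, ((σ i : ℤ) : ℝ) • Φ (x i)) (Measure.pi fun _ => ρ) := by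
    intro σ
    refine (integrable_finsetSum _ fun i _ => Integrable.smul _ ?_).smul _
    exact (measurePreserving_eval (fun _ : Fin n => ρ) i).integrable_comp_of_integrable
      (hΦ.integrable (by norm_num))
  have hrep : ∀ (σ : Fin n → ℤˣ) (x : Fin n → X),
      (⨆ f : F, (1 / (n : ℝ)) * ∑ i, ((σ i : ℤ) : ℝ) * (f : X → ℝ) (x i))
        = ⨆ f : F, inner ℝ (g f) ((1 / (n : ℝ)) • ∑ i, ((σ i : ℤ) : ℝ) • Φ (x i)) := by
    intro σ x
    refine iSup_congr fun f => ?_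
    rw [real_inner_smul_right, inner_sum]
    congr 1
    refine Finset.sum_congr rfl fun i _ => ?_
    rw [real_inner_smul_right, hgf]
  unfold empiricalRademacher
  simp_rw [hrep]
  refine (integrable_finsetSum _ fun σ _ => ?_).const_mul _
  refine ((hv σ).norm.const_mul H).mono'
    ((continuous_iSup_inner hg).comp_aestronglyMeasurable (hv σ).1) ?_
  exact Filter.Eventually.of_forall fun x => abs_iSup_inner_le hg _

/-- A bound on the Rademacher complexity of a class that is controlled, after centering, by the
norms of two random signed sums. -/
theorem rademacher_le_of_signed_sum_le (hn : 0 < n) (hne : F.Nonempty)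
    (hint : Integrable (fun x : Fin n → X => empiricalRademacher F x) (Measure.pi fun _ => ρ))
    {U Q : X → E} (hU : MemLp U 2 ρ) (hQ : MemLp Q 2 ρ) {a b : ℝ} (ha : 0 ≤ a) (hb : 0 ≤ b)
    (f₀ : X → ℝ)
    (hle : ∀ f ∈ F, ∀ (σ : Fin n → ℤˣ) (x : Fin n → X),
      ∑ i, ((σ i : ℤ) : ℝ) * (f (x i) - f₀ (x i))
        ≤ a * ‖∑ i, ((σ i : ℤ) : ℝ) • U (x i)‖ + b * ‖∑ i, ((σ i : ℤ) : ℝ) • Q (x i)‖) :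
    rademacher n ρ F
      ≤ a * √((∫ x, ‖U x‖ ^ 2 ∂ρ) / n) + b * √((∫ x, ‖Q x‖ ^ 2 ∂ρ) / n) := by
  have : Nonempty F := hne.to_subtype
  have hn' : (0 : ℝ) < n := Nat.cast_pos.2 hn
  have hN : (0 : ℝ) < 2 ^ n := by positivity
  have hpt : ∀ x : Fin n → X, empiricalRademacher F x
      ≤ (1 / (n : ℝ)) * (a * √(∑ i, ‖U (x i)‖ ^ 2) + b * √(∑ i, ‖Q (x i)‖ ^ 2)) := by
    intro x
    -- The contribution of the centre `f₀` is kept for each sign vector; it cancels only in the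
    -- average over signs.
    have hσ : ∀ σ : Fin n → ℤˣ,
        (⨆ f : F, (1 / (n : ℝ)) * ∑ i, ((σ i : ℤ) : ℝ) * (f : X → ℝ) (x i))
          ≤ (1 / (n : ℝ)) * (∑ i, ((σ i : ℤ) : ℝ) * f₀ (x i)
            + (a * ‖∑ i, ((σ i : ℤ) : ℝ) • U (x i)‖
              + b * ‖∑ i, ((σ i : ℤ) : ℝ) • Q (x i)‖)) := by
      intro σ
      refine ciSup_le fun f => mul_le_mul_of_nonneg_left ?_ (by positivity)
      have h := hle f f.2 σ x
      simp_rw [mul_sub] at h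
      rw [Finset.sum_sub_distrib] at h
      linarith
    calc empiricalRademacher F x
        ≤ (2 ^ n : ℝ)⁻¹ * ∑ σ : Fin n → ℤˣ, (1 / (n : ℝ)) * (∑ i, ((σ i : ℤ) : ℝ) * f₀ (x i)
            + (a * ‖∑ i, ((σ i : ℤ) : ℝ) • U (x i)‖
              + b * ‖∑ i, ((σ i : ℤ) : ℝ) • Q (x i)‖)) :=
          mul_le_mul_of_nonneg_left (Finset.sum_le_sum fun σ _ => hσ σ) (by positivity)
      _ = (1 / (n : ℝ)) *
          (a * ((2 ^ n : ℝ)⁻¹ * ∑ σ : Fin n → ℤˣ, ‖∑ i, ((σ i : ℤ) : ℝ) • U (x i)‖)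
          + b * ((2 ^ n : ℝ)⁻¹ * ∑ σ : Fin n → ℤˣ, ‖∑ i, ((σ i : ℤ) : ℝ) • Q (x i)‖)) := by
        rw [← Finset.mul_sum, Finset.sum_add_distrib, sum_signs_sum_mul, Finset.sum_add_distrib,
          ← Finset.mul_sum, ← Finset.mul_sum]
        ring
      _ ≤ _ := by
        gcongr
        · exact average_signs_norm_le _
        · exact average_signs_norm_le _
  obtain ⟨hU1, hU2⟩ := integral_average_norm_le (n := n) hU
  obtain ⟨hQ1, hQ2⟩ := integral_average_norm_le (n := n) hQ
  have hscale : ∀ t : ℝ, (1 / (n : ℝ)) * √(n * t) = √(t / n) := by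
    intro t
    have h : t / n = (1 / (n : ℝ)) ^ 2 * (n * t) := by field_simp
    rw [h, Real.sqrt_mul (sq_nonneg _), Real.sqrt_sq (by positivity)]
  calc rademacher n ρ F
      ≤ ∫ x : Fin n → X, (1 / (n : ℝ)) *
          (a * √(∑ i, ‖U (x i)‖ ^ 2) + b * √(∑ i, ‖Q (x i)‖ ^ 2)) ∂(Measure.pi fun _ => ρ) :=
        integral_mono hint (((hU1.const_mul a).add (hQ1.const_mul b)).const_mul _) hpt
    _ = (1 / (n : ℝ)) * (a * ∫ x : Fin n → X, √(∑ i, ‖U (x i)‖ ^ 2) ∂(Measure.pi fun _ => ρ)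
          + b * ∫ x : Fin n → X, √(∑ i, ‖Q (x i)‖ ^ 2) ∂(Measure.pi fun _ => ρ)) := by
        rw [integral_const_mul, integral_add (hU1.const_mul a) (hQ1.const_mul b),
          integral_const_mul, integral_const_mul]
    _ ≤ (1 / (n : ℝ)) * (a * √(n * ∫ x, ‖U x‖ ^ 2 ∂ρ) + b * √(n * ∫ x, ‖Q x‖ ^ 2 ∂ρ)) := by
        gcongr
    _ = _ := by rw [← hscale, ← hscale]; ring

end Sample

/-! ### The fixed point of A√r + B -/

section SubRoot

theorem isSubRoot_mul_sqrt_add {A B : ℝ} (hA : 0 ≤ A) (hB : 0 ≤ B) :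
    IsSubRoot fun s => A * √s + B where
  nonneg r _ := by positivity
  mono r _ s _ hrs := by
    have := Real.sqrt_le_sqrt hrs
    simp only
    gcongr
  anti r hr s hs hrs := by
    have h1 : 0 < √r := Real.sqrt_pos.2 hr
    have h2 : 0 < √s := Real.sqrt_pos.2 hs
    have h3 : √r ≤ √s := Real.sqrt_le_sqrt hrs
    simp only
    rw [add_div, add_div, mul_div_cancel_right₀ _ h1.ne', mul_div_cancel_right₀ _ h2.ne']
    gcongr

/-- The fixed-point equation is quadratic in √r, with positive root (A + D)/2. Strict positivity of
`B` keeps the root positive even when `A = 0`. -/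
theorem exists_fixed_point_mul_sqrt_add {A B : ℝ} (hA : 0 ≤ A) (hB : 0 < B) :
    ∃ r, 0 < r ∧ A * √r + B = r ∧ r ≤ 2 * A ^ 2 + √2 * B := by
  let D := √(A ^ 2 + 4 * B)
  have hD2 : D ^ 2 = A ^ 2 + 4 * B := Real.sq_sqrt (by positivity)
  have hD : 0 < D := Real.sqrt_pos.2 (by positivity)
  have hsq : √(((A + D) / 2) ^ 2) = (A + D) / 2 := Real.sqrt_sq (by positivity)
  refine ⟨((A + D) / 2) ^ 2, by positivity, ?_, ?_⟩
  · rw [hsq]; nlinarith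
  · have h2 : √2 ^ 2 = 2 := Real.sq_sqrt (by norm_num)
    have h14 : (1.4 : ℝ) ≤ √2 := Real.le_sqrt_of_sq_le (by norm_num)
    -- Since r = A²/2 + B + AD/2, this is the claimed bound rearranged. After squaring, the A²B
    -- terms require 12(√2 - 1) ≥ 4, that is √2 ≥ 4/3, for which 1.4 is enough.
    have hAD : A * D ≤ 3 * A ^ 2 + 2 * (√2 - 1) * B := by
      refine abs_le_of_sq_le_sq' ?_ (by nlinarith [sq_nonneg A]) |>.2
      have h3 : 0 ≤ (√2 - 1.4) * (A ^ 2 * B) := mul_nonneg (by linarith) (by positivity)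
      have h4 : 0 ≤ ((√2 - 1) * B) ^ 2 := sq_nonneg _
      have h5 : 0 ≤ A ^ 2 * B := by positivity
      have h6 : 0 ≤ A ^ 4 := by positivity
      rw [mul_pow, hD2]
      nlinarith
    nlinarith

end SubRoot

/-! ### Local complexity and the critical radius -/

section LocalComplexity

variable {X : Type*} [MeasurableSpace X] {ρ : Measure X} {n : ℕ}
  {E : Type*} [NormedAddCommGroup E] [InnerProductSpace ℝ E]
  {Φ : X → E} {F : Set (X → ℝ)} {H : ℝ} {e : ℕ → E} {lam : ℕ → ℝ}

/-- The factors √λ_l and its inverse cancel, and a vanishing eigenvalue does no harm because its `e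
l` is zero. The weight on `h` is the one that turns its norm into an L²(ρ) quantity. -/
theorem inner_eq_inner_residual_add (he : IsPartialOrthonormal e) (hpos : ∀ i, 0 ≤ lam i)
    (h0 : ∀ i, lam i = 0 → e i = 0) (h v : E) (s : Finset ℕ) :
    inner ℝ h v = inner ℝ (∑ l ∈ s, (√(lam l) * inner ℝ (e l) h) • e l)
        (∑ l ∈ s, ((√(lam l))⁻¹ * inner ℝ (e l) v) • e l)
      + inner ℝ h (v - ∑ l ∈ s, inner ℝ (e l) v • e l) := by
  rw [he.inner_sum_smul, inner_sub_right, inner_sum]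
  have : ∑ l ∈ s, √(lam l) * inner ℝ (e l) h * ((√(lam l))⁻¹ * inner ℝ (e l) v) * ‖e l‖ ^ 2
      = ∑ l ∈ s, inner ℝ h (inner ℝ (e l) v • e l) := by
    refine Finset.sum_congr rfl fun l _ => ?_
    rw [real_inner_smul_right, real_inner_comm h]
    by_cases hl : lam l = 0
    · simp [h0 l hl]
    · have hs : √(lam l) ≠ 0 := Real.sqrt_ne_zero'.2 (lt_of_le_of_ne (hpos l) (Ne.symm hl))
      rcases he.zero_or_unit l with h | h
      · simp [h]
      · rw [h]; field_simp
  rw [this]; ring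

theorem memLp_sum_inner_smul (hΦ : MemLp Φ 2 ρ) (s : Finset ℕ) (c : ℕ → ℝ) :
    MemLp (fun x => ∑ l ∈ s, (c l * inner ℝ (e l) (Φ x)) • e l) 2 ρ := by
  have h : ∀ l, MemLp (fun x => (c l * inner ℝ (e l) (Φ x)) • e l) 2 ρ := fun l => by
    let L : E →L[ℝ] E := (ContinuousLinearMap.toSpanSingleton ℝ (e l)) ∘L (c l • innerSL ℝ (e l))
    have := L.comp_memLp' hΦ
    refine this.ae_eq (Filter.Eventually.of_forall fun x => ?_)
    simp [L, mul_smul]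
  exact memLp_finsetSum s fun l _ => h l

variable [IsProbabilityMeasure ρ]

theorem rademacher_local_le (hΦ : MemLp Φ 2 ρ) (he : IsPartialOrthonormal e)
    (hpos : ∀ i, 0 ≤ lam i) (h0 : ∀ i, lam i = 0 → e i = 0)
    (hsum : HasSum lam (∫ x, ‖Φ x‖ ^ 2 ∂ρ))
    (hint : ∀ i, ∫ x, inner ℝ (e i) (Φ x) ^ 2 ∂ρ = lam i)
    (hbessel : ∀ g (s : Finset ℕ), ∑ i ∈ s, lam i * inner ℝ (e i) g ^ 2
        ≤ ∫ x, inner ℝ g (Φ x) ^ 2 ∂ρ)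
    (hF : ∀ f ∈ F, ∃ g : E, ‖g‖ ≤ H ∧ ∀ x, f x = inner ℝ g (Φ x))
    {f₀ : X → ℝ} (hf₀ : f₀ ∈ F) (hn : 0 < n) (j : ℕ) {s : ℝ} (hs : 0 ≤ s) :
    rademacher n ρ {f ∈ F | sqNorm ρ (f - f₀) ≤ s}
      ≤ √((j : ℝ) / n) * √s + 2 * H * √((∑' i, lam (j + i)) / n) := by
  obtain ⟨g₀, hg₀, hg₀f⟩ := hF f₀ hf₀
  have hH : 0 ≤ H := (norm_nonneg _).trans hg₀
  have hmem : f₀ ∈ {f ∈ F | sqNorm ρ (f - f₀) ≤ s} := ⟨hf₀, by simpa [sqNorm] using hs⟩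
  have hF' : ∀ f ∈ {f ∈ F | sqNorm ρ (f - f₀) ≤ s}, ∃ g : E, ‖g‖ ≤ H ∧
      ∀ x, f x = inner ℝ g (Φ x) := fun f hf => hF f hf.1
  let U : X → E := fun x => ∑ l ∈ Finset.range j, ((√(lam l))⁻¹ * inner ℝ (e l) (Φ x)) • e l
  let Q : X → E := fun x => Φ x - ∑ l ∈ Finset.range j, inner ℝ (e l) (Φ x) • e l
  have hU : MemLp U 2 ρ := memLp_sum_inner_smul hΦ _ _
  have hQ : MemLp Q 2 ρ := by
    have := memLp_sum_inner_smul (e := e) hΦ (Finset.range j) 1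
    simp only [Pi.one_apply, one_mul] at this
    exact hΦ.sub this
  have hQ2 : ∫ x, ‖Q x‖ ^ 2 ∂ρ = ∑' i, lam (j + i) := integral_norm_sub_sum_sq hΦ he hint hsum j
  have hU2 : ∫ x, ‖U x‖ ^ 2 ∂ρ ≤ j := by
    have hI : ∀ l, Integrable (fun x => ((√(lam l))⁻¹ * inner ℝ (e l) (Φ x)) ^ 2) ρ := fun l => by
      simp_rw [mul_pow]
      exact (hΦ.const_inner (e l)).integrable_sq.const_mul _
    calc ∫ x, ‖U x‖ ^ 2 ∂ρ
        ≤ ∫ x, ∑ l ∈ Finset.range j, ((√(lam l))⁻¹ * inner ℝ (e l) (Φ x)) ^ 2 ∂ρ :=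
          integral_mono ((memLp_two_iff_integrable_sq_norm hU.1).1 hU)
            (integrable_finsetSum _ fun l _ => hI l) fun x => he.norm_sum_smul_sq_le _ _
      _ = ∑ l ∈ Finset.range j, (lam l)⁻¹ * lam l := by
          rw [integral_finsetSum _ fun l _ => hI l]
          refine Finset.sum_congr rfl fun l _ => ?_
          simp_rw [mul_pow]
          rw [integral_const_mul, hint, inv_pow, Real.sq_sqrt (hpos l)]
      -- Each nonzero eigenvalue contributes 1, a zero eigenvalue contributes 0.
      _ ≤ ∑ l ∈ Finset.range j, 1 := Finset.sum_le_sum fun l _ => inv_mul_le_one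
      _ = j := by simp
  have hmain := rademacher_le_of_signed_sum_le (ρ := ρ) (n := n) hn ⟨f₀, hmem⟩
    (integrable_empiricalRademacher hΦ ⟨f₀, hmem⟩ hF') hU hQ (Real.sqrt_nonneg s)
    (show 0 ≤ 2 * H by positivity) f₀ ?_
  · rw [hQ2] at hmain
    refine hmain.trans ?_
    rw [mul_comm (√s)]
    gcongr
  · intro f hf σ x
    obtain ⟨g, hg, hgf⟩ := hF f hf.1
    set h := g - g₀ with hh
    have hdiff : ∀ x, f x - f₀ x = inner ℝ h (Φ x) := fun x => by
      rw [hgf, hg₀f, inner_sub_left]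
    have hnorm : ‖h‖ ≤ 2 * H := (norm_sub_le _ _).trans (by linarith)
    have hsq : ∫ x, inner ℝ h (Φ x) ^ 2 ∂ρ ≤ s := by
      have := hf.2
      simp only [sqNorm, Pi.sub_apply, hdiff] at this
      exact this
    have hD : ‖∑ l ∈ Finset.range j, (√(lam l) * inner ℝ (e l) h) • e l‖ ≤ √s := by
      refine Real.le_sqrt_of_sq_le ((he.norm_sum_smul_sq_le _ _).trans (le_trans ?_ hsq))
      refine le_trans (le_of_eq ?_) (hbessel h (Finset.range j))
      refine Finset.sum_congr rfl fun l _ => ?_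
      rw [mul_pow, Real.sq_sqrt (hpos l)]
    have hsplit : ∑ i, ((σ i : ℤ) : ℝ) * (f (x i) - f₀ (x i))
        = inner ℝ (∑ l ∈ Finset.range j, (√(lam l) * inner ℝ (e l) h) • e l)
            (∑ i, ((σ i : ℤ) : ℝ) • U (x i)) + inner ℝ h (∑ i, ((σ i : ℤ) : ℝ) • Q (x i)) := by
      rw [inner_sum, inner_sum, ← Finset.sum_add_distrib]
      refine Finset.sum_congr rfl fun i _ => ?_
      rw [real_inner_smul_right, real_inner_smul_right, ← mul_add, hdiff,
        inner_eq_inner_residual_add he hpos h0 h (Φ (x i)) (Finset.range j)]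
    rw [hsplit]
    refine add_le_add ((real_inner_le_norm _ _).trans ?_) ((real_inner_le_norm _ _).trans ?_)
    · gcongr
    · gcongr

/-- The slack `ε` covers `B = 0`, where A√s + B may have no positive fixed point; it disappears on
passing to the infimum. -/
theorem exists_mem_criticalRadiusSet {T : (X → ℝ) → ℝ} {A B : ℝ} (hA : 0 ≤ A) (hB : 0 ≤ B)
    (hle : ∀ s, 0 ≤ s → rademacher n ρ {f ∈ F | T f ≤ s} ≤ A * √s + B) {ε : ℝ} (hε : 0 < ε) :
    ∃ r ∈ criticalRadiusSet n ρ F T, r ≤ 2 * A ^ 2 + √2 * (B + ε) := by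
  have hBε : 0 < B + ε := by positivity
  obtain ⟨r, hr, hfix, hbound⟩ := exists_fixed_point_mul_sqrt_add hA hBε
  refine ⟨r, ⟨hr, _, isSubRoot_mul_sqrt_add hA hBε.le, hfix, fun s hs => ?_⟩, hbound⟩
  have := hle s (hr.le.trans hs)
  linarith

theorem sInf_criticalRadiusSet_le {T : (X → ℝ) → ℝ} {A B : ℝ} (hA : 0 ≤ A) (hB : 0 ≤ B)
    (hle : ∀ s, 0 ≤ s → rademacher n ρ {f ∈ F | T f ≤ s} ≤ A * √s + B) :
    sInf (criticalRadiusSet n ρ F T) ≤ 2 * A ^ 2 + √2 * B := by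
  have hbdd : BddBelow (criticalRadiusSet n ρ F T) := ⟨0, fun r hr => hr.1.le⟩
  have h2 : 0 < √2 := by positivity
  refine le_of_forall_pos_le_add fun δ hδ => ?_
  obtain ⟨r, hr, hrle⟩ := exists_mem_criticalRadiusSet hA hB hle (div_pos hδ h2)
  refine (csInf_le hbdd hr).trans (hrle.trans (le_of_eq ?_))
  rw [mul_add, mul_div_cancel₀ _ h2.ne', add_assoc]

end LocalComplexity

/-! ### The two bounds for the kernel class -/

theorem proposition4 {X : Type*} [MeasurableSpace X]
    (𝓗 : Type*) [NormedAddCommGroup 𝓗] [InnerProductSpace ℝ 𝓗] [CompleteSpace 𝓗]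
    [RKHS ℝ 𝓗 X ℝ]
    (ρ : Measure X) [IsProbabilityMeasure ρ]
    (hmeas : AEStronglyMeasurable (kernelSection 𝓗) ρ)
    (hk : ∀ x : X, scalarKernel 𝓗 x x ≤ 1)
    (lam : ℕ → ℝ)
    (hlam : IsEigenvalueSequence
      (integralOperator ρ (scalarKernel 𝓗) (memLp_scalarKernel 𝓗 hmeas hk)) lam)
    (H : ℝ) (F : Set (X → ℝ))
    (hF : F ⊆ {f | ∃ g : 𝓗, ⇑g = f ∧ ‖g‖ ≤ H})
    (f₀ : X → ℝ) (hf₀ : f₀ ∈ F) (n : ℕ) (hn : 0 < n) :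
    Summable lam ∧
    Integrable (fun x : Fin n → X => empiricalRademacher F x) (Measure.pi fun _ => ρ) ∧
    rademacher n ρ F ≤ H * √(2 / n * ∑' i, min 1 (4 * lam i)) ∧
    (criticalRadiusSet n ρ F fun f => sqNorm ρ (f - f₀)).Nonempty ∧
    criticalRadius n ρ F f₀ ≤
      2 * ⨅ j : ℕ, ((j : ℝ) / n + H * √(2 / n * ∑' i, lam (j + i))) := by
  have hΦ1 : ∀ x, ‖kernelSection 𝓗 x‖ ≤ 1 := fun x => by
    have h := hk x
    rw [scalarKernel_eq_inner, real_inner_self_eq_norm_sq] at h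
    exact (sq_le_one_iff₀ (norm_nonneg _)).1 h
  have hΦ : MemLp (kernelSection 𝓗) 2 ρ :=
    MemLp.of_bound hmeas 1 (Filter.Eventually.of_forall hΦ1)
  have hrep : ∀ f ∈ F, ∃ g : 𝓗, ‖g‖ ≤ H ∧ ∀ x, f x = inner ℝ g (kernelSection 𝓗 x) := by
    intro f hf
    obtain ⟨g, rfl, hg⟩ := hF hf
    exact ⟨g, hg, fun x => by simp [kernelSection]⟩
  have hH : 0 ≤ H := by
    obtain ⟨g, hg, -⟩ := hrep f₀ hf₀
    exact (norm_nonneg g).trans hg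
  obtain ⟨hpos, hsum, e, he, h0, hint, hbessel⟩ := exists_covariance_eigenvectors hΦ
    (memLp_scalarKernel 𝓗 hmeas hk) (scalarKernel_eq_inner 𝓗) hlam
  have hn' : (0 : ℝ) < n := Nat.cast_pos.2 hn
  have hemp : Integrable (fun x : Fin n → X => empiricalRademacher F x)
      (Measure.pi fun _ => ρ) := integrable_empiricalRademacher hΦ ⟨f₀, hf₀⟩ hrep
  have hlocal : ∀ (j : ℕ) (s : ℝ), 0 ≤ s → rademacher n ρ {f ∈ F | sqNorm ρ (f - f₀) ≤ s}
      ≤ √((j : ℝ) / n) * √s + 2 * H * √((∑' i, lam (j + i)) / n) := fun j _ hs =>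
    rademacher_local_le hΦ he hpos h0 hsum hint hbessel hrep hf₀ hn j hs
  refine ⟨hsum.summable, hemp, ?_, ?_, ?_⟩
  -- No centring and no second term are needed here: the centre is 0, and the second copy of the
  -- feature map has coefficient 0.
  · have hle := rademacher_le_of_signed_sum_le (ρ := ρ) (n := n) hn ⟨f₀, hf₀⟩ hemp hΦ hΦ hH le_rfl
      0 (fun f hf σ x => by
        obtain ⟨g, hg, hgf⟩ := hrep f hf
        have h : ∑ i, ((σ i : ℤ) : ℝ) * (f (x i) - (0 : X → ℝ) (x i))
            = inner ℝ g (∑ i, ((σ i : ℤ) : ℝ) • kernelSection 𝓗 (x i)) := by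
          simp [inner_sum, real_inner_smul_right, hgf]
        rw [h, zero_mul, add_zero]
        exact (real_inner_le_norm _ _).trans (by gcongr))
    rw [zero_mul, add_zero] at hle
    refine hle.trans (mul_le_mul_of_nonneg_left (Real.sqrt_le_sqrt ?_) hH)
    have htrace : ∫ x, ‖kernelSection 𝓗 x‖ ^ 2 ∂ρ ≤ 1 := by
      have h := integral_mono ((memLp_two_iff_integrable_sq_norm hΦ.1).1 hΦ)
        (integrable_const (1 : ℝ)) fun x => pow_le_one₀ (norm_nonneg _) (hΦ1 x)
      simpa using h
    have hle1 : ∀ i, lam i ≤ 1 := fun i => (le_hasSum hsum i fun k _ => hpos k).trans htrace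
    have hmin : ∀ i, lam i ≤ min 1 (4 * lam i) := fun i =>
      le_min (hle1 i) (by linarith [hpos i])
    have hmins : Summable fun i => min 1 (4 * lam i) :=
      (hsum.summable.mul_left 4).of_nonneg_of_le (fun i => (hpos i).trans (hmin i))
        fun i => min_le_right _ _
    have h1 : ∫ x, ‖kernelSection 𝓗 x‖ ^ 2 ∂ρ ≤ ∑' i, min 1 (4 * lam i) := by
      rw [← hsum.tsum_eq]
      exact hsum.summable.tsum_le_tsum hmin hmins
    have h2 : 0 ≤ ∑' i, min 1 (4 * lam i) := tsum_nonneg fun i => (hpos i).trans (hmin i)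
    rw [div_mul_eq_mul_div]
    gcongr
    linarith
  · obtain ⟨r, hr, -⟩ := exists_mem_criticalRadiusSet (Real.sqrt_nonneg _)
      (mul_nonneg (mul_nonneg zero_le_two hH) (Real.sqrt_nonneg _)) (hlocal 0) one_pos
    exact ⟨r, hr⟩
  · rw [mul_comm, ← div_le_iff₀ two_pos]
    refine le_ciInf fun j => ?_
    rw [div_le_iff₀ two_pos]
    refine (sInf_criticalRadiusSet_le (Real.sqrt_nonneg _)
      (mul_nonneg (mul_nonneg zero_le_two hH) (Real.sqrt_nonneg _)) (hlocal j)).trans_eq ?_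
    -- The constants match: 2A² + √2 B = 2j/n + 2√2 H √(tail/n), and √2 moves under the root.
    rw [Real.sq_sqrt (by positivity), div_mul_eq_mul_div, mul_div_assoc,
      Real.sqrt_mul zero_le_two]
    ring
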